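/- Let $m,n\in\mathbb N$ and let $\theta$ be a permutation of $\{1,\dots,m\}\times\{1,\dots,n\}$. Let $\mathbb{F}_\theta^+$ be the unital semigroup generated by $e_1,\dots,e_m,f_1,\dots,f_n$ with the relations $e_if_j=f_{j'}e_{i'}$ whenever $\theta(i,j)=(i',j')$. A $*$-representation of $\mathbb{F}_\theta^+$ is a representation $\pi$ by isometries on a complex Hilbert space with $\sum_i\pi(e_i)\pi(e_i)^*=I=\sum_j\pi(f_j)\pi(f_j)^*$. It is atomic if there is an orthonormal basis $\{\xi_k\}$ (the standard basis) such that every $\pi(w)$ maps each $\xi_k$ to a scalar in $\mathbb T\cup\{0\}$ times some $\xi_l$. Write $\dot\xi_k=\mathbb C\xi_k$. The graph of $\pi$ has vertices $\dot\xi_k$, a blue edge labelled $i$ from $\dot\xi_k$ to $\dot\xi_l$ if $\pi(e_i)\dot\xi_k=\dot\xi_l$, and a red edge labelled $j$ from $\dot\xi_k$ to $\dot\xi_l$ if $\pi(f_j)\dot\xi_k=\dot\xi_l$; every vertex has exactly one incoming edge of each colour. An atomic $*$-representation $\pi$ is called inductive (type 3a) if (i) its graph is non-empty and connected; (ii) all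 blue components and all red components of the graph are of infinite tail type, that is, the vertices met when pulling back repeatedly from any vertex along the incoming edges of one colour are pairwise distinct; and (iii) for any starting vertex, the vertices met when pulling back repeatedly along the red edges lie in pairwise distinct blue components. For an inductive $\pi$ and a standard basis vector $\xi$, there are unique vertices $\dot\xi_{s,t}$ and indices $i_{s,t}\in\{1,\dots,m\}$, $j_{s,t}\in\{1,\dots,n\}$ ($s,t\le 0$ integers) with $\dot\xi_{0,0}=\dot\xi$ and $$\pi(e_{i_{s,t}})\dot\xi_{s-1,t}=\dot\xi_{s,t},\qquad \pi(f_{j_{s,t}})\dot\xi_{s,t-1}=\dot\xi_{s,t}\qquad(s,t\le0).$$ Put $\Sigma(\pi,\xi)=\{(i_{s,t},j_{s,t}) : s,t\le 0\}$. Two such data sets $(i^{(1)}_{s,t},j^{(1)}_{s,t})$ and $(i^{(2)}_{s,t},j^{(2)}_{s,t})$ are shift tail equivalent if there are $(p,q)\in\mathbb Z^2$ and an integer $T$ (with $T,\,T+p,\,T+q\le 0$) such that $(i^{(1)}_{s+p,t+q},j^{(1)}_{s+p,t+q})=(i^{(2)}_{s,t},j^{(2)}_{s,t})$ for all $s,t\le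 T$. This is an equivalence relation. Theorem. If $\pi$ is an inductive (type 3a) atomic $*$-representation, then the shift tail equivalence class $\Sigma(\pi)$ of $\Sigma(\pi,\xi)$ does not depend on the choice of the standard basis vector $\xi$. Two inductive $*$-representations $\pi_1,\pi_2$ of $\mathbb{F}_\theta^+$ (each with any standard basis as above) are unitarily equivalent if and only if $\Sigma(\pi_1)=\Sigma(\pi_2)$. -/

import Mathlib

/-! ### The semigroup of a permutation of `m × n` -/

/-- The commutation relations `e_i f_j = f_{j'} e_{i'}` where `θ (i, j) = (i', j')`.
The letters are `e_i` (`Sum.inl i`) and `f_j` (`Sum.inr j`). -/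
inductive ThetaRel {m n : ℕ} (θ : Equiv.Perm (Fin m × Fin n)) :
    FreeMonoid (Fin m ⊕ Fin n) → FreeMonoid (Fin m ⊕ Fin n) → Prop
  | comm (i : Fin m) (j : Fin n) : ThetaRel θ
      (FreeMonoid.of (Sum.inl i) * FreeMonoid.of (Sum.inr j))
      (FreeMonoid.of (Sum.inr (θ (i, j)).2) * FreeMonoid.of (Sum.inl (θ (i, j)).1))

/-- The unital semigroup `𝔽_θ⁺` generated by `e_1, …, e_m, f_1, …, f_n` subject to the
commutation relations. -/
abbrev FTheta {m n : ℕ} (θ : Equiv.Perm (Fin m × Fin n)) : Type :=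
  PresentedMonoid (ThetaRel θ)

namespace FTheta

variable {m n : ℕ} (θ : Equiv.Perm (Fin m × Fin n))

/-- The generator `e_i`. -/
def e (i : Fin m) : FTheta θ := PresentedMonoid.of (ThetaRel θ) (Sum.inl i)

/-- The generator `f_j`. -/
def f (j : Fin n) : FTheta θ := PresentedMonoid.of (ThetaRel θ) (Sum.inr j)

theorem e_mul_f (i : Fin m) (j : Fin n) :
    e θ i * f θ j = f θ (θ (i, j)).2 * e θ (θ (i, j)).1 :=
  PresentedMonoid.mk_eq_mk_of_rel (ThetaRel.comm i j)

/-! ### Representations -/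

variable {θ} {H : Type*} [NormedAddCommGroup H] [InnerProductSpace ℂ H] [CompleteSpace H]

/-- A `*`-representation: every element acts as an isometry, and the representation is
defect free, i.e. `∑ π(e_i) π(e_i)^* = I = ∑ π(f_j) π(f_j)^*`. -/
structure IsStarRep (π : FTheta θ →* (H →L[ℂ] H)) : Prop where
  isometric : ∀ w, Isometry (π w)
  defectFree_e :
    ∑ i, π (e θ i) * ContinuousLinearMap.adjoint (π (e θ i)) = 1
  defectFree_f :
    ∑ j, π (f θ j) * ContinuousLinearMap.adjoint (π (f θ j)) = 1

/-- The orthonormal basis `b` is permuted, up to scalars in `𝕋 ∪ {0}`, by every `π(w)`. -/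
def IsAtomicBasis {ι : Type*} (π : FTheta θ →* (H →L[ℂ] H)) (b : HilbertBasis ι ℂ H) : Prop :=
  ∀ (w : FTheta θ) (k : ι), ∃ (l : ι) (α : ℂ), (α = 0 ∨ ‖α‖ = 1) ∧ π w (b k) = α • b l

/-- `π(w)` maps the line spanned by `b k` onto the line spanned by `b l`. -/
def Edge {ι : Type*} (π : FTheta θ →* (H →L[ℂ] H)) (b : HilbertBasis ι ℂ H)
    (w : FTheta θ) (k l : ι) : Prop :=
  ∃ α : ℂ, ‖α‖ = 1 ∧ π w (b k) = α • b l

/-- There is a blue edge from `k` to `l` in the graph of the representation. -/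
def BlueEdge {ι : Type*} (π : FTheta θ →* (H →L[ℂ] H)) (b : HilbertBasis ι ℂ H)
    (k l : ι) : Prop :=
  ∃ i, Edge π b (e θ i) k l

/-- There is a red edge from `k` to `l` in the graph of the representation. -/
def RedEdge {ι : Type*} (π : FTheta θ →* (H →L[ℂ] H)) (b : HilbertBasis ι ℂ H)
    (k l : ι) : Prop :=
  ∃ j, Edge π b (f θ j) k l

/-- `k` and `l` lie in the same blue component: they are joined by an undirected path of
blue edges. -/
def SameBlueComponent {ι : Type*} (π : FTheta θ →* (H →L[ℂ] H)) (b : HilbertBasis ι ℂ H)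
    (k l : ι) : Prop :=
  Relation.EqvGen (BlueEdge π b) k l

/-- Pulling back from `k` along the edges of a colour one meets infinitely many distinct
vertices, i.e. the component of `k` in that colour is of infinite tail type (the alternative
is that the component contains a ring, into which every pulled back path runs). -/
def OnInfiniteTail {ι : Type*} (E : ι → ι → Prop) (k : ι) : Prop :=
  ∃ x : ℕ → ι, x 0 = k ∧ (∀ r, E (x (r + 1)) (x r)) ∧ Function.Injective x

/-- `π` is an atomic `*`-representation of inductive type (type 3a), with standard basis `b`. -/
structure IsInductive {ι : Type*} (π : FTheta θ →* (H →L[ℂ] H)) (b : HilbertBasis ι ℂ H) :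
    Prop where
  isStarRep : IsStarRep π
  isAtomicBasis : IsAtomicBasis π b
  /-- The graph of the representation is connected (and has a vertex). -/
  nonempty : Nonempty ι
  connected : ∀ k l, Relation.EqvGen (fun x y => BlueEdge π b x y ∨ RedEdge π b x y) k l
  /-- All blue and all red components are of infinite tail type. -/
  blueTail : ∀ k, OnInfiniteTail (BlueEdge π b) k
  redTail : ∀ k, OnInfiniteTail (RedEdge π b) k
  /-- The blue components met when pulling back along red edges are all distinct. -/
  distinct : ∀ y : ℕ → ι, (∀ t, RedEdge π b (y (t + 1)) (y t)) →
    ∀ s t, s ≠ t → ¬ SameBlueComponent π b (y s) (y t)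

/-- Unitary equivalence of representations. -/
def UnitarilyEquivalent {H₁ H₂ : Type*} [NormedAddCommGroup H₁] [InnerProductSpace ℂ H₁]
    [NormedAddCommGroup H₂] [InnerProductSpace ℂ H₂]
    (π₁ : FTheta θ →* (H₁ →L[ℂ] H₁)) (π₂ : FTheta θ →* (H₂ →L[ℂ] H₂)) : Prop :=
  ∃ U : H₁ ≃ₗᵢ[ℂ] H₂, ∀ (w : FTheta θ) (x : H₁), U (π₁ w x) = π₂ w (U x)

/-! ### Index data and shift tail equivalence -/

/-- Index data `(i_{s,t}, j_{s,t})` for integers `s, t ≤ 0`; the value at `a b : ℕ` is the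
pair of index `(s, t) = (-a, -b)`. -/
abbrev IndexData (m n : ℕ) : Type := ℕ → ℕ → Fin m × Fin n

/-- `S` is the index data obtained by pulling back from the basis vector `b k`: there are basis
lines `x_{s,t}`, `s, t ≤ 0`, with `x_{0,0} = b k`, with `π(e_{i_{s,t}})` taking `x_{s-1,t}` to
`x_{s,t}` and with `π(f_{j_{s,t}})` taking `x_{s,t-1}` to `x_{s,t}`. -/
def IsIndexData {ι : Type*} (π : FTheta θ →* (H →L[ℂ] H)) (b : HilbertBasis ι ℂ H) (k : ι)
    (S : IndexData m n) : Prop :=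
  ∃ x : ℕ → ℕ → ι, x 0 0 = k ∧ ∀ s t : ℕ,
    Edge π b (e θ (S s t).1) (x (s + 1) t) (x s t) ∧
    Edge π b (f θ (S s t).2) (x s (t + 1)) (x s t)

/-- Shift tail equivalence: for some `(p, q) ∈ ℤ²` and some bound `T = -N`, one has
`S₁ (s + p, t + q) = S₂ (s, t)` for all `s, t ≤ T`. Here `(s, t) = (-a, -b)` and
`(s + p, t + q) = (-a', -b')`. -/
def ShiftTailEquiv {m n : ℕ} (S₁ S₂ : IndexData m n) : Prop :=
  ∃ (p q : ℤ) (N : ℕ), ∀ a b a' b' : ℕ, N ≤ a → N ≤ b →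
    -(a' : ℤ) = -(a : ℤ) + p → -(b' : ℤ) = -(b : ℤ) + q → S₁ a' b' = S₂ a b

theorem ShiftTailEquiv.equivalence (m n : ℕ) :
    Equivalence (ShiftTailEquiv (m := m) (n := n)) where
  refl S := by
    refine ⟨0, 0, 0, fun a b a' b' _ _ ha hb => ?_⟩
    obtain rfl : a' = a := by omega
    obtain rfl : b' = b := by omega
    rfl
  symm := by
    rintro S₁ S₂ ⟨p, q, N, h⟩
    refine ⟨-p, -q, N + p.natAbs + q.natAbs, fun a b a' b' ha hb ha' hb' => ?_⟩
    exact (h a' b' a b (by omega) (by omega) (by omega) (by omega)).symm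
  trans := by
    rintro S₁ S₂ S₃ ⟨p, q, N, h⟩ ⟨p', q', N', h'⟩
    refine ⟨p + p', q + q', N + N' + p'.natAbs + q'.natAbs, fun a b a' b' ha hb ha' hb' => ?_⟩
    obtain ⟨c, hc⟩ : ∃ c : ℕ, (c : ℤ) = a - p' := ⟨((a : ℤ) - p').toNat, by omega⟩
    obtain ⟨d, hd⟩ : ∃ d : ℕ, (d : ℤ) = b - q' := ⟨((b : ℤ) - q').toNat, by omega⟩
    rw [h c d a' b' (by omega) (by omega) (by omega) (by omega),
      h' a b c d (by omega) (by omega) (by omega) (by omega)]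

/-- Index data modulo shift tail equivalence. -/
def shiftTailSetoid (m n : ℕ) : Setoid (IndexData m n) :=
  ⟨ShiftTailEquiv, ShiftTailEquiv.equivalence m n⟩

section Existence

set_option linter.unusedSectionVars false

variable {ι : Type*} {π : FTheta θ →* (H →L[ℂ] H)} {b : HilbertBasis ι ℂ H}

theorem exists_inEdge (hb : IsAtomicBasis π b) {r : ℕ} (A : Fin r → FTheta θ)
    (hA : ∑ i, π (A i) * ContinuousLinearMap.adjoint (π (A i)) = 1) (k : ι) :
    ∃ i l, Edge π b (A i) l k := by
  classical
  by_contra! hno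
  have key : ∀ i, ContinuousLinearMap.adjoint (π (A i)) (b k) = 0 := by
    intro i
    apply b.repr.injective
    rw [map_zero]
    ext l
    rw [b.repr_apply_apply, ContinuousLinearMap.adjoint_inner_right]
    obtain ⟨l', α, hα, h⟩ := hb (A i) l
    rw [h, inner_smul_left, orthonormal_iff_ite.mp b.orthonormal]
    rcases hα with rfl | hα
    · simp
    · split_ifs with hl
      · subst hl
        exact absurd ⟨α, hα, h⟩ (hno i l)
      · simp
  have h1 := congrArg (fun T : H →L[ℂ] H => T (b k)) hA
  simp [sum_apply, key] at h1
  have := b.orthonormal.1 k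
  rw [← h1] at this
  simp at this

theorem inEdge_unique (hπ : ∀ w, Isometry (π w)) {r : ℕ} (A : Fin r → FTheta θ)
    (hA : ∑ i, π (A i) * ContinuousLinearMap.adjoint (π (A i)) = 1) {k l l' : ι} {i i' : Fin r}
    (h : Edge π b (A i) l k) (h' : Edge π b (A i') l' k) : i = i' ∧ l = l' := by
  classical
  obtain ⟨α, hα, h⟩ := h
  obtain ⟨β, hβ, h'⟩ := h'
  have hα0 : α ≠ 0 := by rintro rfl; simp at hα
  have hβ0 : β ≠ 0 := by rintro rfl; simp at hβ
  have hn : ∀ w x, ‖π w x‖ = ‖x‖ := fun w x => by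
    simpa using (hπ w).dist_eq x 0
  have hk : ‖b k‖ = 1 := b.orthonormal.1 k
  have hadj : ∀ w x, ContinuousLinearMap.adjoint (π w) (π w x) = x := fun w x => by
    refine ext_inner_left ℂ fun v => ?_
    rw [ContinuousLinearMap.adjoint_inner_right]
    exact (⟨(π w : H →ₗ[ℂ] H), hn w⟩ : H →ₗᵢ[ℂ] H).inner_map_map v x
  have hone : ∀ {i : Fin r} {l : ι} {α : ℂ}, ‖α‖ = 1 → π (A i) (b l) = α • b k →
      ‖ContinuousLinearMap.adjoint (π (A i)) (b k)‖ = 1 := by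
    intro i l α hα h
    have h2 := congrArg (fun z => ‖z‖) (hadj (A i) (b l))
    rw [h, map_smul] at h2
    simpa [norm_smul, hα, b.orthonormal.1 l] using h2
  have hsum : ∑ i, ‖ContinuousLinearMap.adjoint (π (A i)) (b k)‖ ^ 2 = 1 := by
    have h1 := congrArg (fun T : H →L[ℂ] H => RCLike.re (inner ℂ (T (b k)) (b k))) hA
    simp only [sum_apply, sum_inner, map_sum, mul_apply_eq_comp,
      one_apply_eq_self] at h1
    have h2 : ∀ i, RCLike.re (inner ℂ (π (A i) (ContinuousLinearMap.adjoint (π (A i)) (b k)))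
        (b k)) = ‖ContinuousLinearMap.adjoint (π (A i)) (b k)‖ ^ 2 := by
      intro i
      rw [← ContinuousLinearMap.adjoint_inner_right, inner_self_eq_norm_sq]
    rw [Finset.sum_congr rfl fun i _ => h2 i, inner_self_eq_norm_sq, hk] at h1
    simpa using h1
  have hii : i = i' := by
    by_contra hne
    have := Finset.add_le_sum (f := fun i => ‖ContinuousLinearMap.adjoint (π (A i)) (b k)‖ ^ 2)
      (fun i _ => sq_nonneg _) (Finset.mem_univ i) (Finset.mem_univ i') hne
    rw [hsum, hone hα h, hone hβ h'] at this
    norm_num at this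
  refine ⟨hii, ?_⟩
  subst hii
  by_contra hne
  have h0 : β • b l = α • b l' := by
    apply (hπ (A i)).injective
    rw [map_smul, map_smul, h, h', smul_comm]
  have h3 := congrArg (fun z => inner ℂ (b l') z) h0
  simp only [inner_smul_right, orthonormal_iff_ite.mp b.orthonormal] at h3
  rw [if_neg (Ne.symm hne)] at h3
  simp at h3
  exact hα0 h3.symm

theorem exists_outEdge (hπ : ∀ w, Isometry (π w)) (hb : IsAtomicBasis π b)
    (w : FTheta θ) (k : ι) : ∃ l, Edge π b w k l := by
  obtain ⟨l, α, hα, h⟩ := hb w k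
  refine ⟨l, α, hα.resolve_left ?_, h⟩
  rintro rfl
  have h1 := (hπ w).dist_eq (b k) 0
  simp [h, b.orthonormal.1 k] at h1

theorem Edge.mul {w w' : FTheta θ} {k l p : ι} (h : Edge π b w k l) (h' : Edge π b w' l p) :
    Edge π b (w' * w) k p := by
  obtain ⟨α, hα, h⟩ := h
  obtain ⟨β, hβ, h'⟩ := h'
  refine ⟨α * β, by simp [hα, hβ], ?_⟩
  rw [map_mul]
  change π w' (π w (b k)) = _
  rw [h, map_smul, h', smul_smul]

theorem Edge.target_unique {w : FTheta θ} {k l p : ι} (h : Edge π b w k l)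
    (h' : Edge π b w k p) : l = p := by
  classical
  obtain ⟨α, hα, h⟩ := h
  obtain ⟨β, hβ, h'⟩ := h'
  by_contra hne
  have h3 := congrArg (fun z => inner ℂ (b l) z) (h.symm.trans h')
  simp only [inner_smul_right, orthonormal_iff_ite.mp b.orthonormal] at h3
  rw [if_neg hne] at h3
  simp at h3
  simp [h3] at hα

/-- In the graph of an atomic `*`-representation one can pull back indefinitely, and the red and
blue pull backs commute; so the index data exists. -/
theorem exists_isIndexData (hπ : IsStarRep π) (hb : IsAtomicBasis π b) (k : ι) :
    ∃ S, IsIndexData π b k S := by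
  choose i B hB using exists_inEdge hb _ hπ.defectFree_e
  choose j R hR using exists_inEdge hb _ hπ.defectFree_f
  have hcomm : Function.Commute B R := by
    intro k
    have h1 := (hR (B k)).mul (hB k)
    rw [e_mul_f] at h1
    obtain ⟨v, hv⟩ := exists_outEdge hπ.isometric hb (e θ (θ (i k, j (B k))).1) (R (B k))
    obtain ⟨u, hu⟩ := exists_outEdge hπ.isometric hb (f θ (θ (i k, j (B k))).2) v
    obtain rfl := h1.target_unique (hv.mul hu)
    obtain ⟨-, rfl⟩ := inEdge_unique hπ.isometric _ hπ.defectFree_f hu (hR _)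
    exact (inEdge_unique hπ.isometric _ hπ.defectFree_e hv (hB _)).2.symm
  refine ⟨fun s t => (i (B^[s] (R^[t] k)), j (B^[s] (R^[t] k))),
    fun s t => B^[s] (R^[t] k), rfl, fun s t => ⟨?_, ?_⟩⟩
  · simp only [Function.iterate_succ_apply']
    exact hB _
  · simp only [Function.iterate_succ_apply']
    rw [(hcomm.iterate_left s) (R^[t] k)]
    exact hR _

theorem IsIndexData.unique (hπ : IsStarRep π) {k : ι} {S S' : IndexData m n}
    (h : IsIndexData π b k S) (h' : IsIndexData π b k S') : S = S' := by
  obtain ⟨x, hx, h⟩ := h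
  obtain ⟨x', hx', h'⟩ := h'
  have hB := fun {k l l' i i'} =>
    inEdge_unique (b := b) hπ.isometric (e θ) hπ.defectFree_e (k := k) (l := l) (l' := l')
      (i := i) (i' := i')
  have hR := fun {k l l' i i'} =>
    inEdge_unique (b := b) hπ.isometric (f θ) hπ.defectFree_f (k := k) (l := l) (l' := l')
      (i := i) (i' := i')
  have hxx : ∀ s t, x s t = x' s t := by
    intro s
    induction s with
    | zero =>
      intro t
      induction t with
      | zero => rw [hx, hx']
      | succ t ih => exact (hR (h 0 t).2 (ih ▸ (h' 0 t).2)).2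
    | succ s ih => exact fun t => (hB (h s t).1 (ih t ▸ (h' s t).1)).2
  funext s t
  exact Prod.ext (hB (h s t).1 (hxx s t ▸ (h' s t).1)).1 (hR (h s t).2 (hxx s t ▸ (h' s t).2)).1

end Existence

/-- The index data `Σ(π, b k)` of an inductive representation, at the basis vector `b k`. -/
noncomputable def indexData {ι : Type*} {π : FTheta θ →* (H →L[ℂ] H)} {b : HilbertBasis ι ℂ H}
    (h : IsInductive π b) (k : ι) : IndexData m n :=
  (exists_isIndexData h.isStarRep h.isAtomicBasis k).choose

theorem indexData_spec {ι : Type*} {π : FTheta θ →* (H →L[ℂ] H)} {b : HilbertBasis ι ℂ H}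
    (h : IsInductive π b) (k : ι) : IsIndexData π b k (indexData h k) :=
  (exists_isIndexData h.isStarRep h.isAtomicBasis k).choose_spec

/-- The shift tail equivalence class of the index data `Σ(π, b k)`. -/
noncomputable def sigmaClass {ι : Type*} {π : FTheta θ →* (H →L[ℂ] H)} {b : HilbertBasis ι ℂ H}
    (h : IsInductive π b) (k : ι) : Quotient (shiftTailSetoid m n) :=
  Quotient.mk (shiftTailSetoid m n) (indexData h k)

end FTheta

/-!
The graph of an inductive representation is studied through its blue and red predecessor maps `B`
and `R` (pulling back along the unique incoming edge). The commutation relations make them commute,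
so the index data at `k` is read off at the vertices `B^s R^t k`, and passing from a vertex to a
neighbour shifts the index data by one. By connectedness the class of the index data is therefore
independent of the vertex (`IsInductive.sigmaClass_eq`).

*Unitary equivalence implies equal classes.* If `U` intertwines the representations, some `U (b₁ k)`
is not orthogonal to some `b₂ l`, although `U` need not match the two bases. As the ranges of the
`π(e_i)`, and those of the `π(f_j)`, are pairwise orthogonal, the incoming edges of `k` and `l`
carry the same labels, and the sources are again non-orthogonal because `U` and the `π(w)` preserve
inner products. Inductively the index data of `k` and `l` coincide
(`IsIndexData.eq_of_inner_ne_zero`).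

*Equal classes imply unitary equivalence.* After moving both base points back along the grid the
index data agree. Pulling back along the diagonal then gives, in both representations, vectors `η_r`
spanning basis lines, with `π(v_r) η_{r+1} = η_r` for the same semigroup elements `v_r`. Every
vertex is reached from some `η_r` by connectedness (`IsInductive.exists_edge_of_diagonal`), so the
vectors `π(w) η_r` have dense span. Moreover an element of the semigroup is determined by the
endpoints of any path it labels (`IsInductive.edge_left_unique`): the path can be replaced by a grid
path, `c` red edges followed by `a` blue ones, and the endpoints determine `c`, because the blue
components along a red pull back are distinct, and then `a`, because blue pull backs never repeat.
Hence for fixed `r` the vectors `π(w) η_r` are orthonormal, all inner products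
`⟨π(w) η_r, π(w') η_s⟩` are determined by the `v_r`, and `π₁(w) η_r ↦ π₂(w) η'_r` extends to the
required unitary.
-/

/-! ### Unitaries from equal Gram matrices -/

/-- Two families with dense span and the same Gram matrix are matched by a unitary. -/
theorem exists_linearIsometryEquiv_of_inner_eq {𝕜 T H₁ H₂ : Type*} [RCLike 𝕜]
    [NormedAddCommGroup H₁] [InnerProductSpace 𝕜 H₁] [CompleteSpace H₁]
    [NormedAddCommGroup H₂] [InnerProductSpace 𝕜 H₂] [CompleteSpace H₂]
    (g₁ : T → H₁) (g₂ : T → H₂)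
    (hd₁ : (Submodule.span 𝕜 (Set.range g₁)).topologicalClosure = ⊤)
    (hd₂ : (Submodule.span 𝕜 (Set.range g₂)).topologicalClosure = ⊤)
    (hg : ∀ s t, inner 𝕜 (g₁ s) (g₁ t) = inner 𝕜 (g₂ s) (g₂ t)) :
    ∃ U : H₁ ≃ₗᵢ[𝕜] H₂, ∀ t, U (g₁ t) = g₂ t := by
  have hr₁ : DenseRange (Finsupp.linearCombination 𝕜 g₁) := by
    rw [DenseRange, ← LinearMap.coe_range, Finsupp.range_linearCombination]
    exact Submodule.dense_iff_topologicalClosure_eq_top.mpr hd₁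
  have hr₂ : DenseRange (Finsupp.linearCombination 𝕜 g₂) := by
    rw [DenseRange, ← LinearMap.coe_range, Finsupp.range_linearCombination]
    exact Submodule.dense_iff_topologicalClosure_eq_top.mpr hd₂
  have hn : ∀ x, ‖Finsupp.linearCombination 𝕜 g₂ (LinearEquiv.refl 𝕜 (T →₀ 𝕜) x)‖ =
      ‖Finsupp.linearCombination 𝕜 g₁ x‖ := by
    intro x
    rw [@norm_eq_sqrt_re_inner 𝕜, @norm_eq_sqrt_re_inner 𝕜]
    simp only [LinearEquiv.refl_apply, Finsupp.linearCombination_apply, Finsupp.sum_inner,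
      Finsupp.inner_sum, inner_smul_left, inner_smul_right, hg]
  refine ⟨(LinearEquiv.refl 𝕜 (T →₀ 𝕜)).extendOfIsometry _ _ hr₁ hr₂ hn, fun t => ?_⟩
  simpa using (LinearEquiv.refl 𝕜 (T →₀ 𝕜)).extendOfIsometry_eq _ _ hr₁ hr₂ hn
    (Finsupp.single t 1)

set_option linter.unusedSectionVars false

namespace FTheta

variable {m n : ℕ} {θ : Equiv.Perm (Fin m × Fin n)}
  {H : Type*} [NormedAddCommGroup H] [InnerProductSpace ℂ H] [CompleteSpace H]
  {H₁ : Type*} [NormedAddCommGroup H₁] [InnerProductSpace ℂ H₁] [CompleteSpace H₁]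
  {H₂ : Type*} [NormedAddCommGroup H₂] [InnerProductSpace ℂ H₂] [CompleteSpace H₂]
  {ι ι₁ ι₂ : Type*}
  {π : FTheta θ →* (H →L[ℂ] H)} {b : HilbertBasis ι ℂ H}
  {π₁ : FTheta θ →* (H₁ →L[ℂ] H₁)} {b₁ : HilbertBasis ι₁ ℂ H₁}
  {π₂ : FTheta θ →* (H₂ →L[ℂ] H₂)} {b₂ : HilbertBasis ι₂ ℂ H₂}

/-! ### Isometries and orthogonal ranges -/

theorem norm_apply_of_isometry (hπ : ∀ w, Isometry (π w)) (w : FTheta θ) (x : H) :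
    ‖π w x‖ = ‖x‖ := by
  simpa using (hπ w).dist_eq x 0

theorem inner_apply_apply_of_isometry (hπ : ∀ w, Isometry (π w)) (w : FTheta θ) (x y : H) :
    inner ℂ (π w x) (π w y) = inner ℂ x y :=
  (⟨(π w : H →ₗ[ℂ] H), norm_apply_of_isometry hπ w⟩ : H →ₗᵢ[ℂ] H).inner_map_map x y

theorem inner_apply_eq_zero_of_ne (hπ : ∀ w, Isometry (π w)) {r : ℕ} (A : Fin r → FTheta θ)
    (hA : ∑ i, π (A i) * ContinuousLinearMap.adjoint (π (A i)) = 1) {i j : Fin r} (hij : i ≠ j)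
    (x y : H) : inner ℂ (π (A i) x) (π (A j) y) = 0 := by
  classical
  have hadj : ContinuousLinearMap.adjoint (π (A i)) (π (A i) x) = x :=
    ext_inner_left ℂ fun v => by
      rw [ContinuousLinearMap.adjoint_inner_right, inner_apply_apply_of_isometry hπ]
  -- The term `i` of the defect identity already reproduces `π (A i) x`.
  have hsum : ∑ k ∈ Finset.univ.erase i,
      ‖ContinuousLinearMap.adjoint (π (A k)) (π (A i) x)‖ ^ 2 = 0 := by
    have h1 := congrArg (fun T : H →L[ℂ] H =>
      RCLike.re (inner ℂ (T (π (A i) x)) (π (A i) x))) hA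
    simp only [sum_apply, sum_inner, map_sum, mul_apply_eq_comp, one_apply_eq_self] at h1
    have h2 : ∀ k, RCLike.re (inner ℂ
        (π (A k) (ContinuousLinearMap.adjoint (π (A k)) (π (A i) x))) (π (A i) x)) =
        ‖ContinuousLinearMap.adjoint (π (A k)) (π (A i) x)‖ ^ 2 := fun k => by
      rw [← ContinuousLinearMap.adjoint_inner_right, inner_self_eq_norm_sq]
    rw [Finset.sum_congr rfl fun k _ => h2 k, inner_self_eq_norm_sq,
      ← Finset.add_sum_erase _ _ (Finset.mem_univ i), hadj, norm_apply_of_isometry hπ] at h1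
    linarith
  have hz := (Finset.sum_eq_zero_iff_of_nonneg fun _ _ => sq_nonneg _).mp hsum j
    (Finset.mem_erase.mpr ⟨hij.symm, Finset.mem_univ j⟩)
  rw [← ContinuousLinearMap.adjoint_inner_left,
    norm_eq_zero.mp ((pow_eq_zero_iff two_ne_zero).mp hz), inner_zero_left]

theorem exists_edge_of_edge_mul (hπ : ∀ w, Isometry (π w)) (hb : IsAtomicBasis π b)
    {w w' : FTheta θ} {k l : ι} (h : Edge π b (w * w') k l) :
    ∃ p, Edge π b w' k p ∧ Edge π b w p l := by
  obtain ⟨p, hp⟩ := exists_outEdge hπ hb w' k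
  obtain ⟨q, hq⟩ := exists_outEdge hπ hb w p
  obtain rfl := h.target_unique (hp.mul hq)
  exact ⟨p, hp, hq⟩

theorem Edge.one (k : ι) : Edge π b 1 k k := ⟨1, by simp, by simp⟩

/-! ### Index data -/

/-- If an isometric intertwiner carries `b₁ k` to a vector not orthogonal to `b₂ l`, then incoming
edges at `k` and at `l` carry the same label, and their sources are not orthogonal either. -/
theorem Edge.label_eq_of_inner_ne_zero (hπ : ∀ w, Isometry (π₂ w)) (U : H₁ ≃ₗᵢ[ℂ] H₂)
    (hU : ∀ w x, U (π₁ w x) = π₂ w (U x)) {r : ℕ} (A : Fin r → FTheta θ)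
    (hA : ∑ i, π₂ (A i) * ContinuousLinearMap.adjoint (π₂ (A i)) = 1)
    {i j : Fin r} {k k' : ι₁} {l l' : ι₂}
    (hk : Edge π₁ b₁ (A i) k' k) (hl : Edge π₂ b₂ (A j) l' l)
    (h : inner ℂ (U (b₁ k)) (b₂ l) ≠ 0) :
    i = j ∧ inner ℂ (U (b₁ k')) (b₂ l') ≠ 0 := by
  obtain ⟨α, hα, hk⟩ := hk
  obtain ⟨β, hβ, hl⟩ := hl
  have hα0 : α ≠ 0 := by rintro rfl; simp at hα
  have hβ0 : β ≠ 0 := by rintro rfl; simp at hβ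
  have key : inner ℂ (π₂ (A i) (U (b₁ k'))) (π₂ (A j) (b₂ l')) ≠ 0 := by
    rw [← hU, hk, hl, map_smul, inner_smul_left, inner_smul_right]
    exact mul_ne_zero ((map_ne_zero _).mpr hα0) (mul_ne_zero hβ0 h)
  obtain rfl : i = j := by
    by_contra hij
    exact key (inner_apply_eq_zero_of_ne hπ A hA hij _ _)
  exact ⟨rfl, by rwa [inner_apply_apply_of_isometry hπ] at key⟩

/-- Basis vectors that an intertwining unitary does not make orthogonal have equal index data. -/
theorem IsIndexData.eq_of_inner_ne_zero (hπ : IsStarRep π₂) (U : H₁ ≃ₗᵢ[ℂ] H₂)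
    (hU : ∀ w x, U (π₁ w x) = π₂ w (U x)) {k : ι₁} {l : ι₂} {S S' : IndexData m n}
    (hS : IsIndexData π₁ b₁ k S) (hS' : IsIndexData π₂ b₂ l S')
    (h : inner ℂ (U (b₁ k)) (b₂ l) ≠ 0) : S = S' := by
  obtain ⟨x, rfl, hx⟩ := hS
  obtain ⟨y, rfl, hy⟩ := hS'
  have hne : ∀ s t, inner ℂ (U (b₁ (x s t))) (b₂ (y s t)) ≠ 0 := by
    intro s
    induction s with
    | zero =>
      intro t
      induction t with
      | zero => exact h
      | succ t ih => exact (Edge.label_eq_of_inner_ne_zero hπ.isometric U hU (f θ)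
          hπ.defectFree_f (hx 0 t).2 (hy 0 t).2 ih).2
    | succ s ih => exact fun t => (Edge.label_eq_of_inner_ne_zero hπ.isometric U hU (e θ)
          hπ.defectFree_e (hx s t).1 (hy s t).1 (ih t)).2
  funext s t
  exact Prod.ext
    (Edge.label_eq_of_inner_ne_zero hπ.isometric U hU (e θ) hπ.defectFree_e
      (hx s t).1 (hy s t).1 (hne s t)).1
    (Edge.label_eq_of_inner_ne_zero hπ.isometric U hU (f θ) hπ.defectFree_f
      (hx s t).2 (hy s t).2 (hne s t)).1

theorem IsIndexData.exists_shift {k : ι} {S : IndexData m n} (h : IsIndexData π b k S)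
    (a c : ℕ) : ∃ l, IsIndexData π b l fun s t => S (a + s) (c + t) := by
  obtain ⟨x, -, hx⟩ := h
  exact ⟨x a c, fun s t => x (a + s) (c + t), rfl, fun s t => hx (a + s) (c + t)⟩

namespace IsInductive

/-! ### Predecessors in the graph -/

/-- The label of the blue edge ending at `k`. -/
noncomputable def blueLabel (h : IsInductive π b) (k : ι) : Fin m :=
  (exists_inEdge h.isAtomicBasis _ h.isStarRep.defectFree_e k).choose

/-- The source of the blue edge ending at `k`. -/
noncomputable def bluePred (h : IsInductive π b) (k : ι) : ι :=
  (exists_inEdge h.isAtomicBasis _ h.isStarRep.defectFree_e k).choose_spec.choose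

/-- The label of the red edge ending at `k`. -/
noncomputable def redLabel (h : IsInductive π b) (k : ι) : Fin n :=
  (exists_inEdge h.isAtomicBasis _ h.isStarRep.defectFree_f k).choose

/-- The source of the red edge ending at `k`. -/
noncomputable def redPred (h : IsInductive π b) (k : ι) : ι :=
  (exists_inEdge h.isAtomicBasis _ h.isStarRep.defectFree_f k).choose_spec.choose

theorem edge_bluePred (h : IsInductive π b) (k : ι) :
    Edge π b (e θ (h.blueLabel k)) (h.bluePred k) k :=
  (exists_inEdge h.isAtomicBasis _ h.isStarRep.defectFree_e k).choose_spec.choose_spec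

theorem edge_redPred (h : IsInductive π b) (k : ι) :
    Edge π b (f θ (h.redLabel k)) (h.redPred k) k :=
  (exists_inEdge h.isAtomicBasis _ h.isStarRep.defectFree_f k).choose_spec.choose_spec

theorem eq_of_edge_e (h : IsInductive π b) {i : Fin m} {k l : ι} (hkl : Edge π b (e θ i) k l) :
    h.blueLabel l = i ∧ h.bluePred l = k :=
  inEdge_unique h.isStarRep.isometric _ h.isStarRep.defectFree_e (h.edge_bluePred l) hkl

theorem eq_of_edge_f (h : IsInductive π b) {j : Fin n} {k l : ι} (hkl : Edge π b (f θ j) k l) :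
    h.redLabel l = j ∧ h.redPred l = k :=
  inEdge_unique h.isStarRep.isometric _ h.isStarRep.defectFree_f (h.edge_redPred l) hkl

/-- The commuting square above a vertex `k`: its two paths carry the two sides of a defining
relation of the semigroup. -/
theorem square (h : IsInductive π b) (k : ι) :
    h.bluePred (h.redPred k) = h.redPred (h.bluePred k) ∧
      f θ (h.redLabel k) * e θ (h.blueLabel (h.redPred k)) =
        e θ (h.blueLabel k) * f θ (h.redLabel (h.bluePred k)) := by
  have h1 := (h.edge_redPred (h.bluePred k)).mul (h.edge_bluePred k)
  rw [e_mul_f] at h1 ⊢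
  obtain ⟨p, hp, hpk⟩ := exists_edge_of_edge_mul h.isStarRep.isometric h.isAtomicBasis h1
  obtain ⟨hj, rfl⟩ := h.eq_of_edge_f hpk
  obtain ⟨hi, hB⟩ := h.eq_of_edge_e hp
  rw [hi, hj]
  exact ⟨hB, rfl⟩

theorem commute_pred (h : IsInductive π b) : Function.Commute h.bluePred h.redPred :=
  fun k => (h.square k).1

theorem isIndexData_iterate (h : IsInductive π b) (k : ι) : IsIndexData π b k fun s t =>
    (h.blueLabel (h.bluePred^[s] (h.redPred^[t] k)),
      h.redLabel (h.bluePred^[s] (h.redPred^[t] k))) := by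
  refine ⟨fun s t => h.bluePred^[s] (h.redPred^[t] k), rfl, fun s t => ⟨?_, ?_⟩⟩
  · simp only [Function.iterate_succ_apply']
    exact h.edge_bluePred _
  · simp only [Function.iterate_succ_apply']
    rw [(h.commute_pred.iterate_left s) (h.redPred^[t] k)]
    exact h.edge_redPred _

theorem indexData_eq (h : IsInductive π b) (k : ι) (s t : ℕ) : indexData h k s t =
    (h.blueLabel (h.bluePred^[s] (h.redPred^[t] k)),
      h.redLabel (h.bluePred^[s] (h.redPred^[t] k))) :=
  congrFun (congrFun ((indexData_spec h k).unique h.isStarRep (h.isIndexData_iterate k)) s) t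

theorem sigmaClass_eq_of_blueEdge (h : IsInductive π b) {k l : ι} (hkl : BlueEdge π b k l) :
    sigmaClass h k = sigmaClass h l := by
  obtain ⟨i, hi⟩ := hkl
  obtain ⟨-, rfl⟩ := h.eq_of_edge_e hi
  refine Quotient.sound ⟨1, 0, 1, fun s t s' t' hs _ hs' ht' => ?_⟩
  obtain rfl : t' = t := by omega
  obtain rfl : s = s' + 1 := by omega
  rw [indexData_eq, indexData_eq, Function.iterate_succ_apply,
    (h.commute_pred.iterate_right t').eq]

theorem sigmaClass_eq_of_redEdge (h : IsInductive π b) {k l : ι} (hkl : RedEdge π b k l) :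
    sigmaClass h k = sigmaClass h l := by
  obtain ⟨j, hj⟩ := hkl
  obtain ⟨-, rfl⟩ := h.eq_of_edge_f hj
  refine Quotient.sound ⟨0, 1, 1, fun s t s' t' _ ht hs' ht' => ?_⟩
  obtain rfl : s' = s := by omega
  obtain rfl : t = t' + 1 := by omega
  rw [indexData_eq, indexData_eq, Function.iterate_succ_apply]

theorem sigmaClass_eq (h : IsInductive π b) (k l : ι) : sigmaClass h k = sigmaClass h l := by
  have := h.connected k l
  induction this with
  | rel x y hxy => exact hxy.elim h.sigmaClass_eq_of_blueEdge h.sigmaClass_eq_of_redEdge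
  | refl x => rfl
  | symm x y _ ih => exact ih.symm
  | trans x y z _ _ ih₁ ih₂ => exact ih₁.trans ih₂

/-! ### Grid paths -/

/-- The label of the blue path of length `a` ending at `l`. -/
noncomputable def blueWord (h : IsInductive π b) (l : ι) : ℕ → FTheta θ
  | 0 => 1
  | a + 1 => e θ (h.blueLabel l) * blueWord h (h.bluePred l) a

/-- The label of the red path of length `c` ending at `l`. -/
noncomputable def redWord (h : IsInductive π b) (l : ι) : ℕ → FTheta θ
  | 0 => 1
  | c + 1 => f θ (h.redLabel l) * redWord h (h.redPred l) c

/-- The label of the path from `R^c B^a l` to `l`: `c` red edges followed by `a` blue edges. -/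
noncomputable def gridWord (h : IsInductive π b) (l : ι) (a c : ℕ) : FTheta θ :=
  h.blueWord l a * h.redWord (h.bluePred^[a] l) c

theorem edge_blueWord (h : IsInductive π b) (l : ι) (a : ℕ) :
    Edge π b (h.blueWord l a) (h.bluePred^[a] l) l := by
  induction a generalizing l with
  | zero => exact Edge.one l
  | succ a ih => exact (ih _).mul (h.edge_bluePred l)

theorem edge_redWord (h : IsInductive π b) (l : ι) (c : ℕ) :
    Edge π b (h.redWord l c) (h.redPred^[c] l) l := by
  induction c generalizing l with
  | zero => exact Edge.one l
  | succ c ih => exact (ih _).mul (h.edge_redPred l)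

theorem edge_gridWord (h : IsInductive π b) (l : ι) (a c : ℕ) :
    Edge π b (h.gridWord l a c) (h.redPred^[c] (h.bluePred^[a] l)) l :=
  (h.edge_redWord _ c).mul (h.edge_blueWord l a)

theorem f_mul_blueWord (h : IsInductive π b) (l : ι) (a : ℕ) :
    f θ (h.redLabel l) * h.blueWord (h.redPred l) a =
      h.blueWord l a * f θ (h.redLabel (h.bluePred^[a] l)) := by
  induction a generalizing l with
  | zero => simp [blueWord]
  | succ a ih =>
    rw [blueWord, blueWord, ← mul_assoc, (h.square l).2, mul_assoc, mul_assoc, (h.square l).1, ih,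
      Function.iterate_succ_apply]

/-- Every path is, up to the relations of the semigroup, a grid path. -/
theorem exists_eq_gridWord (h : IsInductive π b) {w : FTheta θ} {k l : ι}
    (hw : Edge π b w k l) :
    ∃ a c, w = h.gridWord l a c ∧ h.redPred^[c] (h.bluePred^[a] l) = k := by
  obtain ⟨u, rfl⟩ := PresentedMonoid.surjective_mk w
  induction u using FreeMonoid.inductionOn' generalizing l with
  | one =>
    rw [map_one] at hw
    refine ⟨0, 0, ?_, (Edge.one k).target_unique hw |>.symm⟩
    simp [gridWord, blueWord, redWord]
  | of_mul x u ih =>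
    rw [map_mul] at hw ⊢
    obtain ⟨p, hp, hpl⟩ := exists_edge_of_edge_mul h.isStarRep.isometric h.isAtomicBasis hw
    obtain ⟨a, c, hu, hk⟩ := ih hp
    rw [hu]
    cases x with
    | inl i =>
      obtain ⟨rfl, rfl⟩ := h.eq_of_edge_e hpl
      exact ⟨a + 1, c, (mul_assoc _ _ _).symm, hk⟩
    | inr j =>
      obtain ⟨rfl, rfl⟩ := h.eq_of_edge_f hpl
      have hc := (h.commute_pred.iterate_left a).eq l
      refine ⟨a, c + 1, ?_, by rw [Function.iterate_succ_apply, ← hc, hk]⟩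
      change f θ _ * _ = _
      rw [gridWord, gridWord, redWord, ← mul_assoc, h.f_mul_blueWord, mul_assoc, hc]

theorem sameBlueComponent_iterate (h : IsInductive π b) (k : ι) (a : ℕ) :
    SameBlueComponent π b (h.bluePred^[a] k) k := by
  induction a with
  | zero => exact .refl _
  | succ a ih =>
    rw [Function.iterate_succ_apply']
    exact .trans _ _ _ (.rel _ _ ⟨_, h.edge_bluePred _⟩) ih

theorem iterate_bluePred_injective (h : IsInductive π b) (k : ι) :
    Function.Injective fun a => h.bluePred^[a] k := by
  obtain ⟨x, rfl, hx, hinj⟩ := h.blueTail k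
  have hxa : ∀ a, h.bluePred^[a] (x 0) = x a := by
    intro a
    induction a with
    | zero => rfl
    | succ a ih =>
      obtain ⟨i, hi⟩ := hx a
      rw [Function.iterate_succ_apply', ih, (h.eq_of_edge_e hi).2]
  simpa only [hxa] using hinj

/-- The position of a vertex in the grid above `l` determines its coordinates. -/
theorem grid_injective (h : IsInductive π b) (l : ι) {a c a' c' : ℕ}
    (hk : h.redPred^[c] (h.bluePred^[a] l) = h.redPred^[c'] (h.bluePred^[a'] l)) :
    a = a' ∧ c = c' := by
  have hcomm := fun a c => ((h.commute_pred.iterate_left a).iterate_right c).eq l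
  rw [← hcomm, ← hcomm] at hk
  obtain rfl : c = c' := by
    by_contra hne
    refine h.distinct (fun t => h.redPred^[t] l) (fun t => ?_) c c' hne ?_
    · simp only [Function.iterate_succ_apply']
      exact ⟨_, h.edge_redPred _⟩
    · refine .trans _ _ _ (.symm _ _ (h.sameBlueComponent_iterate (h.redPred^[c] l) a)) ?_
      rw [hk]
      exact h.sameBlueComponent_iterate _ a'
  exact ⟨h.iterate_bluePred_injective _ hk, rfl⟩

/-- An element of the semigroup is determined by the endpoints of any path it labels. -/
theorem edge_left_unique (h : IsInductive π b) {w w' : FTheta θ} {k l : ι}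
    (hw : Edge π b w k l) (hw' : Edge π b w' k l) : w = w' := by
  obtain ⟨a, c, rfl, hk⟩ := h.exists_eq_gridWord hw
  obtain ⟨a', c', rfl, hk'⟩ := h.exists_eq_gridWord hw'
  obtain ⟨rfl, rfl⟩ := h.grid_injective l (hk.trans hk'.symm)
  rfl

/-- Any two vertices have a common ancestor. -/
theorem exists_common_ancestor (h : IsInductive π b) (k l : ι) : ∃ a c a' c',
    h.redPred^[c] (h.bluePred^[a] k) = h.redPred^[c'] (h.bluePred^[a'] l) := by
  have := h.connected k l
  induction this with
  | rel x y hxy =>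
    rcases hxy with ⟨i, hi⟩ | ⟨j, hj⟩
    · exact ⟨0, 0, 1, 0, (h.eq_of_edge_e hi).2.symm⟩
    · exact ⟨0, 0, 0, 1, (h.eq_of_edge_f hj).2.symm⟩
  | refl x => exact ⟨0, 0, 0, 0, rfl⟩
  | symm x y _ ih =>
    obtain ⟨a, c, a', c', ih⟩ := ih
    exact ⟨a', c', a, c, ih.symm⟩
  | trans x y z _ _ ih₁ ih₂ =>
    obtain ⟨a₁, c₁, a₁', c₁', ih₁⟩ := ih₁
    obtain ⟨a₂, c₂, a₂', c₂', ih₂⟩ := ih₂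
    have hcomm := fun a c => ((h.commute_pred.iterate_left a).iterate_right c).eq
    refine ⟨a₂ + a₁, c₂ + c₁, a₁' + a₂', c₁' + c₂', ?_⟩
    simp only [Function.iterate_add_apply]
    rw [← hcomm a₂ c₁, ih₁, ← hcomm a₁' c₂', ← ih₂, hcomm a₂ c₁', hcomm a₁' c₂,
      ← Function.iterate_add_apply, ← Function.iterate_add_apply, add_comm c₂,
      ← Function.iterate_add_apply, ← Function.iterate_add_apply, add_comm a₁']

/-- Every vertex is reached from some vertex of the diagonal pull back of `x 0 0`. -/
theorem exists_edge_of_diagonal (h : IsInductive π b) {x : ℕ → ℕ → ι} {S : IndexData m n}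
    (hx : ∀ s t, Edge π b (e θ (S s t).1) (x (s + 1) t) (x s t) ∧
      Edge π b (f θ (S s t).2) (x s (t + 1)) (x s t)) (l : ι) :
    ∃ r w, Edge π b w (x r r) l := by
  have hB : ∀ s t a, h.bluePred^[a] (x s t) = x (s + a) t := by
    intro s t a
    induction a with
    | zero => rfl
    | succ a ih => rw [Function.iterate_succ_apply', ih, (h.eq_of_edge_e (hx (s + a) t).1).2]; rfl
  have hR : ∀ s t c, h.redPred^[c] (x s t) = x s (t + c) := by
    intro s t c
    induction c with
    | zero => rfl
    | succ c ih => rw [Function.iterate_succ_apply', ih, (h.eq_of_edge_f (hx s (t + c)).2).2]; rfl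
  obtain ⟨a, c, a', c', hl⟩ := h.exists_common_ancestor (x 0 0) l
  rw [hB, hR] at hl
  have h1 := h.edge_gridWord l a' c'
  -- From `x a c` pull back further, to the diagonal vertex with both coordinates `a + c`.
  have h2 := h.edge_gridWord (x (0 + a) (0 + c)) c a
  rw [← hl] at h1
  rw [hB, hR, zero_add, zero_add, add_comm c a] at h2
  rw [zero_add, zero_add] at h1
  exact ⟨a + c, _, h2.mul h1⟩

end IsInductive

/-! ### Unitary equivalence from equal index data -/

/-- Along a backward path, basis vectors can be rescaled so that the path carries no scalars. -/
theorem exists_rescaled_path {v : ℕ → FTheta θ} {y : ℕ → ι}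
    (hy : ∀ r, Edge π b (v r) (y (r + 1)) (y r)) :
    ∃ η : ℕ → H, (∀ r, ∃ α : ℂ, ‖α‖ = 1 ∧ η r = α • b (y r)) ∧
      ∀ r, π (v r) (η (r + 1)) = η r := by
  choose α hα hy using hy
  let c : ℕ → ℂ := fun r => ∏ i ∈ Finset.range r, (α i)⁻¹
  refine ⟨fun r => c r • b (y r), fun r => ⟨c r, by simp [c, hα], rfl⟩, fun r => ?_⟩
  have h0 : α r ≠ 0 := by
    intro h0
    simpa [h0] using hα r
  rw [map_smul, hy, smul_smul]
  simp only [c, Finset.prod_range_succ]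
  rw [inv_mul_cancel_right₀ h0]

/-- The element labelling the path of length `d` along `v` that ends at position `r`. -/
def pathWord (v : ℕ → FTheta θ) (r : ℕ) : ℕ → FTheta θ
  | 0 => 1
  | d + 1 => pathWord v r d * v (r + d)

theorem apply_pathWord {v : ℕ → FTheta θ} {η : ℕ → H} (hη : ∀ r, π (v r) (η (r + 1)) = η r)
    (r d : ℕ) : π (pathWord v r d) (η (r + d)) = η r := by
  induction d with
  | zero => simp [pathWord]
  | succ d ih =>
    rw [pathWord, map_mul]
    exact (congrArg _ (hη (r + d))).trans ih

open Classical in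
theorem inner_apply_apply_path {v : ℕ → FTheta θ} {η : ℕ → H}
    (hη : ∀ r, π (v r) (η (r + 1)) = η r)
    (ho : ∀ r w w', inner ℂ (π w (η r)) (π w' (η r)) = if w = w' then 1 else 0)
    (w w' : FTheta θ) (r s : ℕ) : inner ℂ (π w (η r)) (π w' (η s)) =
      if w * pathWord v r s = w' * pathWord v s r then 1 else 0 := by
  rw [← ho (r + s), map_mul, map_mul, mul_apply_eq_comp, mul_apply_eq_comp,
    apply_pathWord hη, add_comm r s, apply_pathWord hη]

/-- Two representations generated by inductive sequences of orthonormal orbits, with the same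
connecting elements `v`, are unitarily equivalent. -/
theorem unitarilyEquivalent_of_path {v : ℕ → FTheta θ} {η₁ : ℕ → H₁} {η₂ : ℕ → H₂}
    (h₁ : ∀ r, π₁ (v r) (η₁ (r + 1)) = η₁ r) (h₂ : ∀ r, π₂ (v r) (η₂ (r + 1)) = η₂ r)
    (ho₁ : ∀ r w w', inner ℂ (π₁ w (η₁ r)) (π₁ w' (η₁ r)) = open Classical in
      if w = w' then 1 else 0)
    (ho₂ : ∀ r w w', inner ℂ (π₂ w (η₂ r)) (π₂ w' (η₂ r)) = open Classical in
      if w = w' then 1 else 0)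
    (hd₁ : (Submodule.span ℂ (Set.range fun p : FTheta θ × ℕ =>
      π₁ p.1 (η₁ p.2))).topologicalClosure = ⊤)
    (hd₂ : (Submodule.span ℂ (Set.range fun p : FTheta θ × ℕ =>
      π₂ p.1 (η₂ p.2))).topologicalClosure = ⊤) :
    UnitarilyEquivalent π₁ π₂ := by
  obtain ⟨U, hU⟩ := exists_linearIsometryEquiv_of_inner_eq _ _ hd₁ hd₂ fun p q => by
    rw [inner_apply_apply_path h₁ ho₁, inner_apply_apply_path h₂ ho₂]
  refine ⟨U, fun w x => ?_⟩
  have hext : (U : H₁ →L[ℂ] H₂).comp (π₁ w) = (π₂ w).comp (U : H₁ →L[ℂ] H₂) := by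
    refine ContinuousLinearMap.ext_on (Submodule.dense_iff_topologicalClosure_eq_top.mpr hd₁) ?_
    rintro _ ⟨⟨w', r⟩, rfl⟩
    have h3 := hU (w * w', r)
    have h4 := hU (w', r)
    simp only [map_mul, mul_apply_eq_comp] at h3 h4
    simpa [h4] using h3
  exact DFunLike.congr_fun hext x

/-- The orbit of a rescaled basis vector is orthonormal and indexed by the semigroup. -/
theorem IsInductive.inner_orbit (h : IsInductive π b) {k : ι} {α : ℂ} (hα : ‖α‖ = 1) {η : H}
    (hη : η = α • b k) (w w' : FTheta θ) : inner ℂ (π w η) (π w' η) = open Classical in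
      if w = w' then 1 else 0 := by
  subst hη
  split_ifs with hw
  · subst hw
    rw [inner_apply_apply_of_isometry h.isStarRep.isometric, inner_self_eq_norm_sq_to_K, norm_smul,
      hα, b.orthonormal.1 k]
    simp
  · obtain ⟨l, hl⟩ := exists_outEdge h.isStarRep.isometric h.isAtomicBasis w k
    obtain ⟨l', hl'⟩ := exists_outEdge h.isStarRep.isometric h.isAtomicBasis w' k
    have hne : l ≠ l' := by
      rintro rfl
      exact hw (h.edge_left_unique hl hl')
    obtain ⟨β, -, hl⟩ := hl
    obtain ⟨γ, -, hl'⟩ := hl'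
    rw [map_smul, map_smul, hl, hl', inner_smul_left, inner_smul_right, inner_smul_left,
      inner_smul_right, b.orthonormal.2 hne]
    simp

/-- The data that an inductive representation and its index data `S` provide along the diagonal:
rescaled basis vectors joined by elements depending on `S` only, whose orbits are orthonormal and
span a dense subspace. -/
theorem IsInductive.exists_path (h : IsInductive π b) {k : ι} {S : IndexData m n}
    (hS : IsIndexData π b k S) : ∃ η : ℕ → H,
      (∀ r, π (e θ (S r r).1 * f θ (S (r + 1) r).2) (η (r + 1)) = η r) ∧
      (∀ r w w', inner ℂ (π w (η r)) (π w' (η r)) = open Classical in if w = w' then 1 else 0) ∧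
      (Submodule.span ℂ (Set.range fun p : FTheta θ × ℕ =>
        π p.1 (η p.2))).topologicalClosure = ⊤ := by
  obtain ⟨x, rfl, hx⟩ := hS
  obtain ⟨η, hη, hv⟩ := exists_rescaled_path (v := fun r => e θ (S r r).1 * f θ (S (r + 1) r).2)
    (y := fun r => x r r) fun r => (hx (r + 1) r).2.mul (hx r r).1
  refine ⟨η, hv, fun r => ?_, ?_⟩
  · obtain ⟨α, hα, hηr⟩ := hη r
    exact h.inner_orbit hα hηr
  · rw [eq_top_iff, ← b.dense_span]
    refine Submodule.topologicalClosure_mono (Submodule.span_le.mpr ?_)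
    rintro _ ⟨l, rfl⟩
    obtain ⟨r, w, β, hβ, hw⟩ := h.exists_edge_of_diagonal hx l
    obtain ⟨α, hα, hηr⟩ := hη r
    have h0 : α * β ≠ 0 := by
      intro h0
      simpa [hα, hβ] using congrArg norm h0
    have hl : b l = (α * β)⁻¹ • π w (η r) := by
      rw [hηr, map_smul, hw, smul_smul α, inv_smul_smul₀ h0]
    rw [hl]
    exact Submodule.smul_mem _ _ (Submodule.subset_span ⟨(w, r), rfl⟩)

theorem IsInductive.unitarilyEquivalent_of_isIndexData (h₁ : IsInductive π₁ b₁)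
    (h₂ : IsInductive π₂ b₂) {k₁ : ι₁} {k₂ : ι₂} {S : IndexData m n}
    (hS₁ : IsIndexData π₁ b₁ k₁ S) (hS₂ : IsIndexData π₂ b₂ k₂ S) :
    UnitarilyEquivalent π₁ π₂ := by
  obtain ⟨η₁, hη₁, ho₁, hd₁⟩ := h₁.exists_path hS₁
  obtain ⟨η₂, hη₂, ho₂, hd₂⟩ := h₂.exists_path hS₂
  exact unitarilyEquivalent_of_path hη₁ hη₂ ho₁ ho₂ hd₁ hd₂

theorem IsInductive.unitarilyEquivalent_of_sigmaClass_eq (h₁ : IsInductive π₁ b₁)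
    (h₂ : IsInductive π₂ b₂) {k₁ : ι₁} {k₂ : ι₂} (hS : sigmaClass h₁ k₁ = sigmaClass h₂ k₂) :
    UnitarilyEquivalent π₁ π₂ := by
  obtain ⟨p, q, N, hpq⟩ : ShiftTailEquiv _ _ := Quotient.exact hS
  -- Beyond the bound `N`, and far enough out for both shifted indices to be natural numbers, the
  -- two data sets agree.
  obtain ⟨a, ha⟩ : ∃ a : ℕ, (a : ℤ) = N + p.natAbs - p := ⟨(N + p.natAbs - p : ℤ).toNat, by omega⟩
  obtain ⟨c, hc⟩ : ∃ c : ℕ, (c : ℤ) = N + q.natAbs - q := ⟨(N + q.natAbs - q : ℤ).toNat, by omega⟩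
  obtain ⟨l₁, hl₁⟩ := (indexData_spec h₁ k₁).exists_shift a c
  obtain ⟨l₂, hl₂⟩ := (indexData_spec h₂ k₂).exists_shift (N + p.natAbs) (N + q.natAbs)
  refine h₁.unitarilyEquivalent_of_isIndexData h₂ hl₁ (k₂ := l₂) ?_
  convert hl₂ using 3 with s t
  exact hpq _ _ _ _ (by omega) (by omega) (by omega) (by omega)

theorem IsInductive.sigmaClass_eq_of_unitarilyEquivalent (h₁ : IsInductive π₁ b₁)
    (h₂ : IsInductive π₂ b₂) (hU : UnitarilyEquivalent π₁ π₂) (k₁ : ι₁) (k₂ : ι₂) :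
    sigmaClass h₁ k₁ = sigmaClass h₂ k₂ := by
  obtain ⟨U, hU⟩ := hU
  -- A nonzero vector cannot be orthogonal to the whole basis `b₂`.
  obtain ⟨l, hl⟩ : ∃ l, inner ℂ (U (b₁ k₁)) (b₂ l) ≠ 0 := by
    by_contra! hno
    have h0 : U (b₁ k₁) = 0 := by
      apply b₂.repr.injective
      rw [map_zero]
      ext l
      rw [b₂.repr_apply_apply, inner_eq_zero_symm.mp (hno l)]
      rfl
    have h1 := U.norm_map (b₁ k₁)
    rw [h0, b₁.orthonormal.1 k₁] at h1
    simp at h1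
  rw [h₂.sigmaClass_eq k₂ l, sigmaClass, sigmaClass,
    (indexData_spec h₁ k₁).eq_of_inner_ne_zero h₂.isStarRep U hU (indexData_spec h₂ l) hl]

end FTheta

theorem mainTheorem10 {m n : ℕ} (θ : Equiv.Perm (Fin m × Fin n))
    {H₁ : Type*} [NormedAddCommGroup H₁] [InnerProductSpace ℂ H₁] [CompleteSpace H₁]
    {H₂ : Type*} [NormedAddCommGroup H₂] [InnerProductSpace ℂ H₂] [CompleteSpace H₂]
    {ι₁ ι₂ : Type*}
    (π₁ : FTheta θ →* (H₁ →L[ℂ] H₁)) (b₁ : HilbertBasis ι₁ ℂ H₁) (h₁ : FTheta.IsInductive π₁ b₁)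
    (π₂ : FTheta θ →* (H₂ →L[ℂ] H₂)) (b₂ : HilbertBasis ι₂ ℂ H₂) (h₂ : FTheta.IsInductive π₂ b₂) :
    (∀ k l : ι₁, FTheta.sigmaClass h₁ k = FTheta.sigmaClass h₁ l) ∧
    (∀ (k₁ : ι₁) (k₂ : ι₂),
      FTheta.UnitarilyEquivalent π₁ π₂ ↔
        FTheta.sigmaClass h₁ k₁ = FTheta.sigmaClass h₂ k₂) :=
  ⟨h₁.sigmaClass_eq, fun k₁ k₂ =>
    ⟨fun hU => h₁.sigmaClass_eq_of_unitarilyEquivalent h₂ hU k₁ k₂,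
      h₁.unitarilyEquivalent_of_sigmaClass_eq h₂⟩⟩
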